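/- Let $m,q,k\ge 1$, let $\Omega$ be an alphabet of size $q$, and let $y\in\Omega^k$. A cyclic sequence $(s)$ over $\Omega$ is the class of all rotations of a linear sequence $s$; these rotations are its linearizations. Occurrences of a $k$-mer (word of length $k$) in $(s)$ are counted by starting positions of $s$ and read cyclically (positions may be reused if $s$ is shorter than $k$). For $m\ge 1$ let $\mathcal{C}(m,q,k)$ be the set of cyclic sequences over $\Omega$ in which every $k$-mer occurs exactly $m$ times, and let $\mathcal{LC}_y(m,q,k)$ be the set of linearizations of elements of $\mathcal{C}(m,q,k)$ that start with $y$ (again read cyclically). The order of a sequence $s$ of length $n$ is the largest $d\mid n$ such that $s$ is invariant under rotation by $n/d$ places; $\mathcal{LC}_y^{(d)}(m,q,k)$ is the set of elements of $\mathcal{LC}_y(m,q,k)$ of order $d$. Let $t^i$ denote the concatenation of $i$ copies of $t$, and $\phi$ Euler's totient function. Then: (1) For every positive divisor $r$ of $m$, $$\{t^{m/r} : t\in\mathcal{LC}_y(r,q,k)\}=\bigcup_{d:\ d\mid m,\ (m/r)\mid d}\mathcal{LC}_y^{(d)}(m,q,k).$$ (2) The set $\mathcal{C}(m,q,k)$ is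 finite and nonempty, as is $\mathcal{LC}_y(r,q,k)$ for each $r\mid m$. For $r\mid m$ put $$p(r)=\frac{\phi(m/r)}{m}\cdot\frac{|\mathcal{LC}_y(r,q,k)|}{|\mathcal{C}(m,q,k)|}.$$ Then $p$ is a probability distribution on the positive divisors of $m$, and $$p(r)=\frac{\phi(m/r)\,(rq)!^{\,q^{k-1}}/\,r!^{\,q^k}}{\sum_{d\mid m}\phi(m/d)\,(dq)!^{\,q^{k-1}}/\,d!^{\,q^k}}.$$ (3) Select a divisor $r$ of $m$ with probability $p(r)$, then select $t$ uniformly at random from $\mathcal{LC}_y(r,q,k)$, and output the cyclic sequence $(t^{m/r})$. The output always lies in $\mathcal{C}(m,q,k)$, and each element of $\mathcal{C}(m,q,k)$ is output with probability $1/|\mathcal{C}(m,q,k)|$. -/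

import Mathlib

open scoped Nat ENNReal

namespace MultiDeBruijn

variable {Ω : Type*}

/-- The `k`-mer `w` occurs in the sequence `s`, read cyclically, at starting position `i`
(positions are counted from `0`). Positions of `s` may be used several times if `s` is
shorter than `k`. -/
def OccursAt {k : ℕ} (w : Fin k → Ω) (s : List Ω) (i : ℕ) : Prop :=
  ∀ j : Fin k, s[(i + (j : ℕ)) % s.length]? = some (w j)

open Classical in
/-- Number of starting positions of `s` at which `w` occurs cyclically. -/
noncomputable def listOccurrences {k : ℕ} (w : Fin k → Ω) (s : List Ω) : ℕ :=
  ((Finset.range s.length).filter (OccursAt w s)).card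

theorem occursAt_rotate {k : ℕ} (w : Fin k → Ω) (s : List Ω) (n i : ℕ) (hs : 0 < s.length) :
    OccursAt w (s.rotate n) i ↔ OccursAt w s ((i + n) % s.length) := by
  unfold OccursAt
  refine forall_congr' fun j => ?_
  rw [List.length_rotate, List.getElem?_rotate (Nat.mod_lt _ hs)]
  have h : ((i + (j : ℕ)) % s.length + n) % s.length
      = ((i + n) % s.length + (j : ℕ)) % s.length := by
    rw [Nat.mod_add_mod, Nat.mod_add_mod]
    congr 1
    omega
  rw [h]

theorem listOccurrences_rotate {k : ℕ} (w : Fin k → Ω) (s : List Ω) (n : ℕ) :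
    listOccurrences w (s.rotate n) = listOccurrences w s := by
  classical
  rcases Nat.eq_zero_or_pos s.length with h0 | hs
  · simp [listOccurrences, h0]
  unfold listOccurrences
  rw [List.length_rotate]
  refine Finset.card_bij (fun i _ => (i + n) % s.length) ?_ ?_ ?_
  · intro i hi
    rw [Finset.mem_filter] at hi ⊢
    exact ⟨Finset.mem_range.2 (Nat.mod_lt _ hs), (occursAt_rotate w s n i hs).1 hi.2⟩
  · intro a ha b hb hab
    rw [Finset.mem_filter, Finset.mem_range] at ha hb
    have h : a ≡ b [MOD s.length] := Nat.ModEq.add_right_cancel' n hab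
    exact Nat.ModEq.eq_of_lt_of_lt h ha.1 hb.1
  · intro b hb
    rw [Finset.mem_filter, Finset.mem_range] at hb
    have hn : n % s.length < s.length := Nat.mod_lt _ hs
    have key : ((b + (s.length - n % s.length)) % s.length + n) % s.length = b := by
      rw [Nat.mod_add_mod, ← Nat.add_mod_mod]
      have : b + (s.length - n % s.length) + n % s.length = b + s.length := by omega
      rw [this, Nat.add_mod_right, Nat.mod_eq_of_lt hb.1]
    refine ⟨(b + (s.length - n % s.length)) % s.length, ?_, key⟩
    rw [Finset.mem_filter]
    refine ⟨Finset.mem_range.2 (Nat.mod_lt _ hs), (occursAt_rotate w s n _ hs).2 ?_⟩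
    rw [key]
    exact hb.2

/-- Number of occurrences of the `k`-mer `w` in a cyclic sequence. -/
noncomputable def occurrences {k : ℕ} (w : Fin k → Ω) (σ : Cycle Ω) : ℕ :=
  Quotient.liftOn σ (listOccurrences w) (by
    rintro s t ⟨n, rfl⟩
    exact (listOccurrences_rotate w s n).symm)

variable (Ω) in
/-- The cyclic multi de Bruijn sequences over `Ω`: every `k`-mer occurs exactly `m` times. -/
def cyclicSeqs (m k : ℕ) : Set (Cycle Ω) :=
  {σ | ∀ w : Fin k → Ω, occurrences w σ = m}

variable (Ω) in
/-- The linearizations of cyclic multi de Bruijn sequences. -/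
def linearizedSeqs (m k : ℕ) : Set (List Ω) :=
  {s | (s : Cycle Ω) ∈ cyclicSeqs Ω m k}

/-- The linearizations that start with the `k`-mer `y`. -/
def linearizedSeqsFrom {k : ℕ} (y : Fin k → Ω) (m : ℕ) : Set (List Ω) :=
  {s | s ∈ linearizedSeqs Ω m k ∧ OccursAt y s 0}

open Classical in
/-- The order of a sequence `s` of length `n`: the largest divisor `d` of `n` such that `s` is
invariant under rotation by `n / d` places. -/
noncomputable def rotationOrder (s : List Ω) : ℕ :=
  (s.length.divisors.filter fun d => s.rotate (s.length / d) = s).sup id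

/-- The linearizations of order `d` that start with the `k`-mer `y`. -/
def linearizedSeqsFromOfOrder {k : ℕ} (y : Fin k → Ω) (d m : ℕ) : Set (List Ω) :=
  {s | s ∈ linearizedSeqsFrom y m ∧ rotationOrder s = d}

/-- The concatenation `t ^ i` of `i` copies of `t`. -/
def power (t : List Ω) (i : ℕ) : List Ω := (List.replicate i t).flatten

/-- The weight `p(r)` with which the divisor `r` of `m` is selected. -/
noncomputable def weight {k : ℕ} (y : Fin k → Ω) (m r : ℕ) : ℝ :=
  (φ (m / r) : ℝ) / (m : ℝ) *
    (((linearizedSeqsFrom y r).ncard : ℝ) / ((cyclicSeqs Ω m k).ncard : ℝ))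

/-- The uniform distribution on a finite nonempty set. -/
noncomputable def uniformOn {α : Type*} (S : Set α) (hf : S.Finite) (hn : S.Nonempty) : PMF α :=
  PMF.uniformOfFinset hf.toFinset (hf.toFinset_nonempty.2 hn)

/-- The law of the output of the following process: select a divisor `r` of `m` with
distribution `P`, then select `t` uniformly among the linearizations with parameter `r` that
start with `y`, and output the cyclic sequence `(t ^ (m / r))`. -/
noncomputable def outputLaw {k : ℕ} (y : Fin k → Ω) (m : ℕ) (P : PMF m.divisors)
    (hf : ∀ r : m.divisors, (linearizedSeqsFrom y (r : ℕ)).Finite)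
    (hn : ∀ r : m.divisors, (linearizedSeqsFrom y (r : ℕ)).Nonempty) : PMF (Cycle Ω) :=
  P.bind fun r =>
    (uniformOn (linearizedSeqsFrom y (r : ℕ)) (hf r) (hn r)).map
      fun t => (power t (m / (r : ℕ)) : Cycle Ω)

end MultiDeBruijn

namespace MultiDeBruijn

section Cardinality

variable {α β : Type*}

theorem ncard_biUnion_finset (t : Finset β) (s : β → Set α)
    (h : (t : Set β).PairwiseDisjoint s) (hs : ∀ b ∈ t, (s b).Finite) :
    (⋃ b ∈ t, s b).ncard = ∑ b ∈ t, (s b).ncard := by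
  rw [← finsum_mem_coe_finset, ← t.finite_toSet.ncard_biUnion hs h]
  rfl

theorem ncard_eq_sum_ncard_fiber {S : Set α} (hS : S.Finite) (f : α → β) (t : Finset β)
    (hf : ∀ a ∈ S, f a ∈ t) : S.ncard = ∑ b ∈ t, {a ∈ S | f a = b}.ncard := by
  rw [← ncard_biUnion_finset]
  · congr 1
    ext a
    simp only [Set.mem_iUnion, Set.mem_ofPred_eq, exists_prop]
    exact ⟨fun h => ⟨f a, hf a h, h, rfl⟩, fun ⟨_, _, h, _⟩ => h⟩
  · intro b _ b' _ hbb'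
    rw [Function.onFun, Set.disjoint_left]
    rintro a ⟨_, h⟩ ⟨_, h'⟩
    exact hbb' (h.symm.trans h')
  · exact fun b _ => hS.subset (Set.sep_subset _ _)

end Cardinality

section Words

variable {Ω : Type*} [Fintype Ω] [DecidableEq Ω]

/-- The words in which every letter `b` occurs exactly `c b` times. -/
def words (c : Ω → ℕ) : Set (List Ω) := {l | ∀ b, l.count b = c b}

theorem length_of_mem_words {c : Ω → ℕ} {l : List Ω} (h : l ∈ words c) :
    l.length = ∑ b, c b := by
  rw [← Finset.sum_congr rfl fun b _ => h b]
  have := Multiset.sum_count_eq_card (s := Finset.univ) (m := (l : Multiset Ω)) (by simp)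
  simpa using this.symm

theorem words_finite (c : Ω → ℕ) : (words c).Finite :=
  (List.finite_length_eq Ω (∑ b, c b)).subset fun _ hl => length_of_mem_words hl

omit [Fintype Ω] in
theorem cons_mem_words_iff {c : Ω → ℕ} {b : Ω} {l : List Ω} :
    b :: l ∈ words c ↔ 0 < c b ∧ l ∈ words (Function.update c b (c b - 1)) := by
  simp only [words, Set.mem_ofPred_eq, List.count_cons, Function.update_apply]
  constructor
  · intro h
    have hb := h b
    simp only [beq_self_eq_true, if_true] at hb
    refine ⟨by omega, fun a => ?_⟩
    have ha := h a
    by_cases hab : a = b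
    · subst hab; simp; omega
    · simp only [if_neg hab]
      have : (b == a) = false := by simpa using Ne.symm hab
      simpa [this] using ha
  · rintro ⟨h0, h⟩ a
    have ha := h a
    by_cases hab : a = b
    · subst hab; simp at ha ⊢; omega
    · have : (b == a) = false := by simpa using Ne.symm hab
      simpa [this, hab] using ha

theorem ncard_words (c : Ω → ℕ) : (words c).ncard * ∏ b, (c b)! = (∑ b, c b)! := by
  obtain ⟨n, hn⟩ : ∃ n, ∑ b, c b = n := ⟨_, rfl⟩
  induction n generalizing c with
  | zero =>
    have h0 : ∀ b, c b = 0 := by simpa using hn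
    have : words c = {[]} := by
      ext l
      simp only [Set.mem_singleton_iff]
      constructor
      · intro h
        exact List.eq_nil_of_length_eq_zero ((length_of_mem_words h).trans hn)
      · rintro rfl b
        simp [h0]
    simp [this, h0]
  | succ n ih =>
    have hunion : words c = ⋃ b ∈ Finset.univ.filter (fun b => 0 < c b),
        (List.cons b) '' words (Function.update c b (c b - 1)) := by
      ext l
      simp only [Finset.mem_filter, Finset.mem_univ, true_and, Set.mem_iUnion, Set.mem_image,
        exists_prop]
      constructor
      · intro h
        cases l with
        | nil => have := length_of_mem_words h; simp at this; omega
        | cons b l =>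
          have := cons_mem_words_iff.1 h
          exact ⟨b, this.1, l, this.2, rfl⟩
      · rintro ⟨b, hb, l, hl, rfl⟩
        exact cons_mem_words_iff.2 ⟨hb, hl⟩
    have hcard : (words c).ncard = ∑ b ∈ Finset.univ.filter (fun b => 0 < c b),
        (words (Function.update c b (c b - 1))).ncard := by
      rw [hunion, ncard_biUnion_finset]
      · exact Finset.sum_congr rfl fun b _ => Set.ncard_image_of_injective _ (List.cons_injective)
      · intro b _ b' _ hbb'
        rw [Function.onFun, Set.disjoint_left]
        rintro _ ⟨l, _, rfl⟩ ⟨l', _, h⟩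
        exact hbb' (List.cons.inj h).1.symm
      · exact fun b _ => (words_finite _).image _
    have hfib : ∀ b ∈ Finset.univ.filter (fun b => 0 < c b),
        (words (Function.update c b (c b - 1))).ncard * ∏ a, (c a)! = c b * n ! := by
      intro b hb
      have hb : 0 < c b := by simpa using hb
      have hs : ∑ a, Function.update c b (c b - 1) a = n := by
        rw [Finset.sum_update_of_mem (Finset.mem_univ b)]
        rw [← Finset.add_sum_erase _ _ (Finset.mem_univ b)] at hn
        rw [Finset.sdiff_singleton_eq_erase]
        omega
      have h := ih _ hs
      rw [hs] at h
      have hp : (∏ a, (Function.update c b (c b - 1) a)!) * c b = ∏ a, (c a)! := by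
        rw [← Finset.mul_prod_erase _ _ (Finset.mem_univ b),
          ← Finset.mul_prod_erase _ (fun a => (c a)!) (Finset.mem_univ b)]
        rw [Function.update_self, mul_right_comm, mul_comm (c b - 1)!,
          Nat.mul_factorial_pred hb.ne']
        congr 1
        refine Finset.prod_congr rfl fun a ha => ?_
        rw [Function.update_of_ne (Finset.ne_of_mem_erase ha)]
      rw [← hp, ← mul_assoc, h, mul_comm]
    rw [hcard, Finset.sum_mul, Finset.sum_congr rfl hfib, ← Finset.sum_mul, Finset.sum_filter]
    have : ∑ b, (if 0 < c b then c b else 0) = n + 1 := by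
      rw [← hn]
      refine Finset.sum_congr rfl fun b _ => ?_
      split_ifs <;> omega
    rw [this, hn, Nat.factorial_succ]

/-- The balanced words, in which every letter occurs exactly `m` times. -/
abbrev balancedWords (Ω : Type*) [Fintype Ω] [DecidableEq Ω] (m : ℕ) : Set (List Ω) :=
  words fun _ : Ω => m

theorem ncard_balancedWords (m : ℕ) :
    (balancedWords Ω m).ncard * m ! ^ Fintype.card Ω = (m * Fintype.card Ω)! := by
  have := ncard_words (fun _ : Ω => m)
  simpa [mul_comm] using this

theorem map_perm_mem_balancedWords {m : ℕ} {l : List Ω} (e : Equiv.Perm Ω)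
    (h : l ∈ balancedWords Ω m) : l.map e ∈ balancedWords Ω m := by
  intro b
  have := List.count_map_of_injective l e e.injective (e.symm b)
  rw [e.apply_symm_apply] at this
  rw [this]
  exact h _

theorem reverse_mem_balancedWords {m : ℕ} {l : List Ω} (h : l ∈ balancedWords Ω m) :
    l.reverse ∈ balancedWords Ω m := by
  intro b
  rw [List.count_reverse]
  exact h b

theorem ncard_balancedWords_head_eq (m : ℕ) (a b : Ω) :
    {l ∈ balancedWords Ω m | l.head? = some a}.ncard
      = {l ∈ balancedWords Ω m | l.head? = some b}.ncard := by
  have key : ∀ a b : Ω, {l ∈ balancedWords Ω m | l.head? = some a}.ncard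
      ≤ {l ∈ balancedWords Ω m | l.head? = some b}.ncard := by
    intro a b
    refine Set.ncard_le_ncard_of_injOn (List.map (Equiv.swap a b)) ?_
      ((List.map_injective_iff.2 (Equiv.injective _)).injOn)
      ((words_finite _).subset (Set.sep_subset _ _))
    rintro l ⟨hl, ha⟩
    exact ⟨map_perm_mem_balancedWords _ hl, by simp [List.head?_map, ha]⟩
  exact le_antisymm (key a b) (key b a)

theorem card_mul_ncard_balancedWords_head {m : ℕ} (hm : 0 < m) (a : Ω) :
    Fintype.card Ω * {l ∈ balancedWords Ω m | l.head? = some a}.ncard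
      = (balancedWords Ω m).ncard := by
  rw [ncard_eq_sum_ncard_fiber (words_finite _) (fun l : List Ω => l.head?)
    (Finset.univ.image some)]
  · rw [Finset.sum_image (fun _ _ _ _ h => Option.some.inj h),
      Finset.sum_congr rfl fun b _ => ncard_balancedWords_head_eq m b a]
    simp
  · intro l h
    cases l with
    | nil => have := h a; simp at this; omega
    | cons b l => simp

theorem ncard_balancedWords_getLast (m : ℕ) (a : Ω) :
    {l ∈ balancedWords Ω m | l.getLast? = some a}.ncard
      = {l ∈ balancedWords Ω m | l.head? = some a}.ncard := by
  rw [← Set.ncard_image_of_injective _ List.reverse_injective]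
  congr 1
  ext l
  constructor
  · rintro ⟨t, ⟨ht, ha⟩, rfl⟩
    exact ⟨reverse_mem_balancedWords ht, by rwa [List.head?_reverse]⟩
  · rintro ⟨hl, ha⟩
    exact ⟨l.reverse, ⟨reverse_mem_balancedWords hl, by rwa [List.getLast?_reverse]⟩,
      List.reverse_reverse l⟩

end Words

section Walks

variable {V Ω : Type*} [DecidableEq V]

/-- The letters read at the state `u` during the walk that reads `s` from the state `v`,
in order. -/
def exits (step : V → Ω → V) : List Ω → V → V → List Ω
  | [], _, _ => []
  | a :: s, v, u => if u = v then a :: exits step s (step v a) u else exits step s (step v a) u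

variable {step : V → Ω → V}

@[simp] theorem exits_nil (v u : V) : exits step [] v u = [] := rfl

theorem exits_cons_self (a : Ω) (s : List Ω) (v : V) :
    exits step (a :: s) v v = a :: exits step s (step v a) v := by simp [exits]

theorem exits_cons_of_ne (a : Ω) (s : List Ω) {v u : V} (h : u ≠ v) :
    exits step (a :: s) v u = exits step s (step v a) u := by simp [exits, h]

theorem exits_append (s t : List Ω) (v u : V) :
    exits step (s ++ t) v u = exits step s v u ++ exits step t (s.foldl step v) u := by
  induction s generalizing v with
  | nil => simp
  | cons a s ih =>
    by_cases h : u = v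
    · subst h
      simp [exits_cons_self, ih]
    · simp [exits_cons_of_ne _ _ h, ih]

theorem exits_injective (v : V) : Function.Injective fun s : List Ω => exits step s v := by
  intro s
  induction s generalizing v with
  | nil =>
    intro t h
    cases t with
    | nil => rfl
    | cons a t => simpa [exits_cons_self] using congrFun h v
  | cons a s ih =>
    intro t h
    cases t with
    | nil => simpa [exits_cons_self] using congrFun h v
    | cons b t =>
      have hv := congrFun h v
      simp only [exits_cons_self, List.cons.injEq] at hv
      obtain ⟨rfl, hv⟩ := hv
      congr 1
      refine ih (step v a) (funext fun u => ?_)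
      by_cases hu : u = v
      · subst hu
        exact hv
      · simpa [exits_cons_of_ne _ _ hu] using congrFun h u

/-- Following the instructions `w` from `v` until they run out at the current state. -/
theorem exists_maximal_walk [Fintype V] (w : V → List Ω) (v : V) :
    ∃ (s : List Ω) (w' : V → List Ω),
      (∀ u, w u = exits step s v u ++ w' u) ∧ w' (s.foldl step v) = [] := by
  obtain ⟨n, hn⟩ : ∃ n, ∑ u, (w u).length = n := ⟨_, rfl⟩
  induction n generalizing w v with
  | zero =>
    refine ⟨[], w, fun u => by simp, ?_⟩
    have : ∀ u, w u = [] := by simpa using hn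
    exact this _
  | succ n ih =>
    cases h : w v with
    | nil => exact ⟨[], w, fun u => by simp, h⟩
    | cons a l =>
      have hn' : ∑ u, (Function.update w v l u).length = n := by
        rw [← Finset.add_sum_erase _ _ (Finset.mem_univ v)] at hn ⊢
        rw [Function.update_self]
        rw [h, List.length_cons] at hn
        have : ∀ u ∈ Finset.univ.erase v, (Function.update w v l u).length = (w u).length := by
          intro u hu
          rw [Function.update_of_ne (Finset.ne_of_mem_erase hu)]
        rw [Finset.sum_congr rfl this]
        omega
      obtain ⟨s, w', hs, hw'⟩ := ih (Function.update w v l) (step v a) hn'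
      refine ⟨a :: s, w', fun u => ?_, hw'⟩
      have := hs u
      by_cases hu : u = v
      · subst hu
        rw [Function.update_self] at this
        rw [exits_cons_self, h, this, List.cons_append]
      · rw [Function.update_of_ne hu] at this
        rw [exits_cons_of_ne _ _ hu, this]

theorem sum_count_exits [Fintype V] [Fintype Ω] [DecidableEq Ω] (s : List Ω) (v u : V) :
    (∑ e ∈ Finset.univ.filter (fun e : V × Ω => step e.1 e.2 = u),
        (exits step s v e.1).count e.2) + (if u = v then 1 else 0)
      = (exits step s v u).length + (if u = s.foldl step v then 1 else 0) := by
  induction s generalizing v with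
  | nil => simp; rfl
  | cons a s ih =>
    have hcount : ∀ e : V × Ω, (exits step (a :: s) v e.1).count e.2
        = (exits step s (step v a) e.1).count e.2 + if e = (v, a) then 1 else 0 := by
      rintro ⟨x, b⟩
      by_cases hx : x = v
      · subst hx
        simp only [exits_cons_self, List.count_cons, Prod.mk.injEq, true_and, beq_iff_eq]
        simp [eq_comm]
      · simp [exits_cons_of_ne _ _ hx, hx]
    have hlen : (exits step (a :: s) v u).length
        = (exits step s (step v a) u).length + if u = v then 1 else 0 := by
      by_cases hu : u = v
      · subst hu
        simp [exits_cons_self]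
      · simp [exits_cons_of_ne _ _ hu, hu]
    have hone : (∑ e ∈ Finset.univ.filter (fun e : V × Ω => step e.1 e.2 = u),
        if e = (v, a) then 1 else 0) = if u = step v a then 1 else 0 := by
      rw [Finset.sum_ite_eq']
      simp [eq_comm]
    have h := ih (step v a)
    rw [List.foldl_cons, Finset.sum_congr rfl fun e _ => hcount e, Finset.sum_add_distrib, hone,
      hlen]
    omega

/-- The functional graph of `g` leads from every state to `v`. -/
def LeadsTo (step : V → Ω → V) (v : V) (g : V → Ω) : Prop :=
  ∀ u, Relation.ReflTransGen (fun x x' => x' = step x (g x)) u v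

theorem reflTransGen_of_exits {v : V} {g : V → Ω} (s : List Ω) (x : V)
    (hs : s.foldl step x = v)
    (hg : ∀ u, u ≠ v → exits step s x u ≠ [] → (exits step s x u).getLast? = some (g u))
    (u : V) (hu : u = v ∨ exits step s x u ≠ []) :
    Relation.ReflTransGen (fun x x' => x' = step x (g x)) u v := by
  induction s generalizing x u with
  | nil =>
    rcases hu with rfl | hu
    · exact .refl
    · simp at hu
  | cons a s ih =>
    have hlast : ∀ u, exits step s (step x a) u ≠ [] →
        (exits step (a :: s) x u).getLast? = (exits step s (step x a) u).getLast? := by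
      intro u hu
      by_cases hx : u = x
      · subst hx
        rw [exits_cons_self, List.getLast?_cons_of_ne_nil hu]
      · rw [exits_cons_of_ne _ _ hx]
    have hne : ∀ u, exits step s (step x a) u ≠ [] → exits step (a :: s) x u ≠ [] := by
      intro u hu
      by_cases hx : u = x
      · subst hx
        simp [exits_cons_self]
      · rwa [exits_cons_of_ne _ _ hx]
    have ih' := ih (step x a) hs fun u huv hu => by
      rw [← hlast u hu]
      exact hg u huv (hne u hu)
    by_cases huv : u = v
    · exact huv ▸ .refl
    have hu := hu.resolve_left huv
    by_cases h : exits step s (step x a) u = []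
    · have hux : u = x := by
        by_contra hux
        rw [exits_cons_of_ne _ _ hux] at hu
        exact hu h
      subst hux
      have hga := hg u huv hu
      rw [exits_cons_self, h] at hga
      have hga : a = g u := by simpa using hga
      refine .head (b := step u a) (by rw [hga]) (ih' _ ?_)
      cases s with
      | nil => exact .inl hs
      | cons b s => exact .inr (by simp [exits_cons_self])
    · exact ih' u (.inr h)

/-- If the instructions use every letter `m` times at every state and their last letters lead
to `v`, then following them from `v` uses all of them. -/
theorem exists_eulerian_walk [Fintype V] [Fintype Ω] [DecidableEq Ω]
    (hreg : ∀ u, (Finset.univ.filter (fun e : V × Ω => step e.1 e.2 = u)).card = Fintype.card Ω)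
    {m : ℕ} {w : V → List Ω} (hw : ∀ u, w u ∈ balancedWords Ω m)
    {v : V} {g : V → Ω} (hg : LeadsTo step v g)
    (hlast : ∀ u, u ≠ v → (w u).getLast? = some (g u)) :
    ∃ s : List Ω, s.foldl step v = v ∧ exits step s v = w := by
  obtain ⟨s, w', hs, hw'⟩ := exists_maximal_walk (step := step) w v
  have hlen : ∀ u, (w u).length = m * Fintype.card Ω := fun u => by
    rw [length_of_mem_words (hw u)]
    simp [mul_comm]
  have hle : ∀ e : V × Ω, (exits step s v e.1).count e.2 ≤ m := fun e => by
    have h := hw e.1 e.2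
    rw [hs, List.count_append] at h
    exact (Nat.le_add_right _ _).trans_eq h
  have hsum : ∀ u, ∑ e ∈ Finset.univ.filter (fun e : V × Ω => step e.1 e.2 = u), m
      = m * Fintype.card Ω := fun u => by
    rw [Finset.sum_const, hreg, smul_eq_mul, mul_comm]
  have hend : s.foldl step v = v := by
    by_contra hne
    have h := sum_count_exits (step := step) s v (s.foldl step v)
    have hfull := hlen (s.foldl step v)
    rw [hs, hw', List.append_nil] at hfull
    have hsl := (Finset.sum_le_sum fun e _ => hle e).trans_eq (hsum (s.foldl step v))
    simp only [hne, if_false, if_true, hfull] at h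
    omega
  refine ⟨s, hend, funext fun u => ?_⟩
  suffices w' u = [] by rw [hs, this, List.append_nil]
  induction hg u using Relation.ReflTransGen.head_induction_on with
  | refl => rw [← hw', hend]
  | @head x x' hx _ ih =>
    by_cases hxv : x = v
    · rw [hxv, ← hw', hend]
    have h := sum_count_exits (step := step) s v x'
    have hfull := hlen x'
    rw [hs, ih, List.append_nil] at hfull
    rw [hend, hfull, add_left_inj, ← hsum x'] at h
    have heq := (Finset.sum_eq_sum_iff_of_le fun e _ => hle e).1 h (x, g x) (by simp [hx])
    have hcount := hw x (g x)
    rw [hs, List.count_append] at hcount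
    have h0 : (w' x).count (g x) = 0 := by
      dsimp only at heq hcount
      omega
    by_contra hnil
    have hl := hlast x hxv
    rw [hs, List.getLast?_append_of_ne_nil _ hnil] at hl
    exact List.count_eq_zero.1 h0 (List.mem_of_getLast? hl)

/-- The closed walks from `v` with first letter `a` that traverse every edge `m` times. -/
def eulerianWalks [DecidableEq Ω] (step : V → Ω → V) (v : V) (a : Ω) (m : ℕ) : Set (List Ω) :=
  {s | s.foldl step v = v ∧ s.head? = some a ∧ ∀ u b, (exits step s v u).count b = m}

/-- The first letter of a word attached to `v`, and the last letter of a word attached to any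
other state. -/
def keyLetter (v u : V) (l : List Ω) : Option Ω := if u = v then l.head? else l.getLast?

theorem image_exits_eulerianWalks [Fintype V] [Fintype Ω] [DecidableEq Ω]
    (hreg : ∀ u, (Finset.univ.filter (fun e : V × Ω => step e.1 e.2 = u)).card = Fintype.card Ω)
    (v : V) (a : Ω) {m : ℕ} (hm : 0 < m) :
    (fun s => exits step s v) '' eulerianWalks step v a m
      = {w | (∀ u, w u ∈ balancedWords Ω m) ∧
          ∃ g : V → Ω, (g v = a ∧ LeadsTo step v g) ∧ ∀ u, keyLetter v u (w u) = some (g u)} := by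
  ext w
  constructor
  · rintro ⟨s, ⟨hend, hhead, hcount⟩, rfl⟩
    refine ⟨hcount, ?_⟩
    have hne : ∀ u, exits step s v u ≠ [] := fun u h => by
      have := hcount u a
      rw [h] at this
      simp at this
      omega
    have hkey : ∀ u, ∃ b, keyLetter v u (exits step s v u) = some b := fun u => by
      unfold keyLetter
      split_ifs
      · exact ⟨_, List.head?_eq_some_head (hne u)⟩
      · exact ⟨_, List.getLast?_eq_some_getLast (hne u)⟩
    choose g hg using hkey
    refine ⟨g, ⟨?_, fun u => ?_⟩, hg⟩
    · have := hg v
      cases s with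
      | nil => simp at hhead
      | cons b s =>
        simp only [keyLetter, if_true, exits_cons_self, List.head?_cons, Option.some.injEq]
          at this hhead
        exact this.symm.trans hhead
    · refine reflTransGen_of_exits s v hend (fun u hu _ => ?_) u (.inr (hne u))
      have := hg u
      rwa [keyLetter, if_neg hu] at this
  · rintro ⟨hw, g, ⟨hga, hg⟩, hkey⟩
    obtain ⟨s, hend, rfl⟩ := exists_eulerian_walk hreg hw hg fun u hu => by
      have := hkey u
      rwa [keyLetter, if_neg hu] at this
    refine ⟨s, ⟨hend, ?_, hw⟩, rfl⟩
    have := hkey v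
    rw [keyLetter, if_pos rfl, hga] at this
    cases s with
    | nil => simp at this
    | cons b s => simpa [exits_cons_self] using this

theorem card_mul_ncard_keyLetter [Fintype Ω] [DecidableEq Ω] {m : ℕ} (hm : 0 < m) (v u : V)
    (a : Ω) : Fintype.card Ω * {l ∈ balancedWords Ω m | keyLetter v u l = some a}.ncard
      = (balancedWords Ω m).ncard := by
  rw [← card_mul_ncard_balancedWords_head hm a]
  unfold keyLetter
  split_ifs
  · rfl
  · rw [ncard_balancedWords_getLast]

theorem ncard_pi [Fintype V] {α : Type*} (S : V → Set α) (hS : ∀ u, (S u).Finite) :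
    {w : V → α | ∀ u, w u ∈ S u}.ncard = ∏ u, (S u).ncard := by
  have : {w : V → α | ∀ u, w u ∈ S u}
      = (Fintype.piFinset fun u => (hS u).toFinset : Set (V → α)) := by
    ext w
    simp
  rw [this, Set.ncard_coe_finset, Fintype.card_piFinset]
  exact Finset.prod_congr rfl fun u _ => (Set.ncard_eq_toFinset_card _ (hS u)).symm

/-- The number of Eulerian walks is proportional to a power of the number of balanced words, with
a factor that does not depend on the multiplicity. -/
theorem ncard_eulerianWalks_mul [Fintype V] [Fintype Ω] [DecidableEq Ω]
    (hreg : ∀ u, (Finset.univ.filter (fun e : V × Ω => step e.1 e.2 = u)).card = Fintype.card Ω)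
    (v : V) (a : Ω) {m : ℕ} (hm : 0 < m) :
    Fintype.card Ω ^ Fintype.card V * (eulerianWalks step v a m).ncard
      = {g : V → Ω | g v = a ∧ LeadsTo step v g}.ncard
          * (balancedWords Ω m).ncard ^ Fintype.card V := by
  classical
  have hG : {g : V → Ω | g v = a ∧ LeadsTo step v g}.Finite := Set.toFinite _
  have hunion : {w : V → List Ω | (∀ u, w u ∈ balancedWords Ω m) ∧
      ∃ g : V → Ω, (g v = a ∧ LeadsTo step v g) ∧ ∀ u, keyLetter v u (w u) = some (g u)}
      = ⋃ g ∈ hG.toFinset,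
          {w | ∀ u, w u ∈ {l ∈ balancedWords Ω m | keyLetter v u l = some (g u)}} := by
    ext w
    simp only [Set.mem_ofPred_eq, Set.Finite.mem_toFinset, Set.mem_iUnion, exists_prop]
    constructor
    · rintro ⟨hw, g, hg, hk⟩
      exact ⟨g, hg, fun u => ⟨hw u, hk u⟩⟩
    · rintro ⟨g, hg, h⟩
      exact ⟨fun u => (h u).1, g, hg, fun u => (h u).2⟩
  have hfin : ∀ (g : V → Ω) (u : V),
      {l ∈ balancedWords Ω m | keyLetter v u l = some (g u)}.Finite :=
    fun g u => (words_finite _).subset (Set.sep_subset _ _)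
  rw [← Set.ncard_image_of_injective _ (exits_injective (step := step) v),
    image_exits_eulerianWalks hreg v a hm, hunion, ncard_biUnion_finset, Finset.mul_sum]
  · have : ∀ g ∈ hG.toFinset, Fintype.card Ω ^ Fintype.card V *
        {w : V → List Ω | ∀ u, w u ∈ {l ∈ balancedWords Ω m | keyLetter v u l = some (g u)}}.ncard
        = (balancedWords Ω m).ncard ^ Fintype.card V := by
      intro g _
      rw [ncard_pi _ (hfin g), ← Finset.card_univ (α := V), ← Finset.prod_const, ← Finset.prod_const,
        ← Finset.prod_mul_distrib]
      exact Finset.prod_congr rfl fun u _ => card_mul_ncard_keyLetter hm v u (g u)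
    rw [Finset.sum_congr rfl this, Finset.sum_const, smul_eq_mul, Set.ncard_eq_toFinset_card _ hG]
  · intro g _ g' _ hgg'
    rw [Function.onFun, Set.disjoint_left]
    intro w h h'
    exact hgg' (funext fun u => Option.some.inj ((h u).2.symm.trans (h' u).2))
  · intro g _
    exact Set.Finite.subset (Set.Finite.pi' (hfin g)) fun w h => h

/-- A state that can be reached from everywhere is the target of some functional graph. -/
theorem exists_leadsTo {v : V} (a : Ω) (h : ∀ u, ∃ s : List Ω, s.foldl step u = v) :
    ∃ g : V → Ω, g v = a ∧ LeadsTo step v g := by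
  classical
  have hd : ∀ u, ∃ n, ∃ s : List Ω, s.length = n ∧ s.foldl step u = v := fun u =>
    (h u).elim fun s hs => ⟨s.length, s, rfl, hs⟩
  have hnext : ∀ u, ∃ b, u ≠ v → Nat.find (hd (step u b)) < Nat.find (hd u) := by
    intro u
    by_cases huv : u = v
    · exact ⟨a, fun h => absurd huv h⟩
    obtain ⟨s, hs, hsv⟩ := Nat.find_spec (hd u)
    cases s with
    | nil => exact absurd hsv huv
    | cons b s =>
      refine ⟨b, fun _ => ?_⟩
      rw [← hs]
      exact (Nat.find_min' (hd (step u b)) ⟨s, rfl, hsv⟩).trans_lt (by simp)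
  choose f hf using hnext
  refine ⟨Function.update f v a, Function.update_self .., fun u => ?_⟩
  induction hn : Nat.find (hd u) using Nat.strong_induction_on generalizing u with
  | _ n ih =>
    by_cases huv : u = v
    · exact huv ▸ .refl
    refine .head rfl ?_
    rw [Function.update_of_ne huv]
    exact ih _ (hn ▸ hf u huv) _ rfl

end Walks

section DeBruijnGraph

variable {Ω : Type*} {k : ℕ}

/-- The transitions of the de Bruijn graph on words of length `k`. -/
def shift (u : Fin k → Ω) (b : Ω) : Fin k → Ω :=
  Fin.tail (Fin.snoc u b : Fin (k + 1) → Ω)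

/-- The factor of length `k` of the sequence `x` at position `i`. -/
def window (k : ℕ) (x : ℕ → Ω) (i : ℕ) : Fin k → Ω := fun j => x (i + j)

theorem snoc_window (x : ℕ → Ω) (i : ℕ) :
    (Fin.snoc (window k x i) (x (i + k)) : Fin (k + 1) → Ω) = window (k + 1) x i := by
  ext j
  refine Fin.lastCases ?_ (fun j => ?_) j
  · simp [window]
  · simp [window]

theorem shift_window (x : ℕ → Ω) (i : ℕ) :
    shift (window k x i) (x (i + k)) = window k x (i + 1) := by
  rw [shift, snoc_window]
  ext j
  simp only [Fin.tail, window, Fin.val_succ]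
  congr 1
  omega

theorem foldl_shift_range (x : ℕ → Ω) (n : ℕ) :
    ((List.range n).map fun i => x (i + k)).foldl shift (window k x 0) = window k x n := by
  induction n with
  | zero => rfl
  | succ n ih => simp [List.range_succ, ih, shift_window]

theorem count_exits_shift_range [DecidableEq Ω] (x : ℕ → Ω) (n : ℕ) (u : Fin k → Ω) (b : Ω) :
    (exits shift ((List.range n).map fun i => x (i + k)) (window k x 0) u).count b
      = ((Finset.range n).filter
          fun i => window (k + 1) x i = (Fin.snoc u b : Fin (k + 1) → Ω)).card := by
  induction n with
  | zero => rfl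
  | succ n ih =>
    rw [List.range_succ, List.map_append, exits_append, List.count_append, ih, foldl_shift_range,
      Finset.range_add_one, Finset.filter_insert, ← snoc_window x n]
    by_cases hu : window k x n = u
    · subst hu
      by_cases hb : x (n + k) = b
      · subst hb
        simp [exits_cons_self]
      · have : ¬ (Fin.snoc (window k x n) (x (n + k)) : Fin (k + 1) → Ω)
            = Fin.snoc (window k x n) b := fun h => hb (by simpa using congrFun h (Fin.last k))
        simp [exits_cons_self, hb, this]
    · have : ¬ (Fin.snoc (window k x n) (x (n + k)) : Fin (k + 1) → Ω) = Fin.snoc u b :=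
        fun h => hu (by simpa using congrArg Fin.init h)
      simp [exits_cons_of_ne _ _ (Ne.symm hu), this]

theorem card_filter_shift_eq [Fintype Ω] [DecidableEq Ω] (u : Fin k → Ω) :
    (Finset.univ.filter (fun e : (Fin k → Ω) × Ω => shift e.1 e.2 = u)).card
      = Fintype.card Ω := by
  symm
  refine Finset.card_nbij'
    (fun b => (Fin.init (Fin.cons b u : Fin (k + 1) → Ω),
      (Fin.cons b u : Fin (k + 1) → Ω) (Fin.last k)))
    (fun e => (Fin.snoc e.1 e.2 : Fin (k + 1) → Ω) 0) ?_ ?_ ?_ ?_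
  · intro b _
    refine Finset.mem_coe.2 (Finset.mem_filter.2 ⟨Finset.mem_univ _, ?_⟩)
    simp [shift]
  · intro e _
    simp
  · intro b _
    simp
  · rintro ⟨v, b⟩ h
    have h : shift v b = u := by simpa using h
    subst h
    simp [shift]

theorem exists_foldl_shift_eq (u v : Fin k → Ω) : ∃ s : List Ω, s.foldl shift u = v := by
  rcases Nat.eq_zero_or_pos k with rfl | hk
  · exact ⟨[], Subsingleton.elim _ _⟩
  let x : ℕ → Ω := fun i => if h : i < k then u ⟨i, h⟩ else v ⟨(i - k) % k, Nat.mod_lt _ hk⟩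
  refine ⟨(List.range k).map fun i => x (i + k), ?_⟩
  have h0 : window k x 0 = u := by
    ext j
    simp [window, x]
  rw [← h0, foldl_shift_range]
  ext j
  simp [window, x, Nat.mod_eq_of_lt]

end DeBruijnGraph

section Linearizations

variable {Ω : Type*} {k : ℕ}

/-- The periodic infinite sequence with period `s`. -/
def unroll (s : List Ω) (hs : 0 < s.length) (i : ℕ) : Ω := s[i % s.length]'(Nat.mod_lt _ hs)

theorem occursAt_iff_window (w : Fin k → Ω) {s : List Ω} (hs : 0 < s.length) (i : ℕ) :
    OccursAt w s i ↔ window k (unroll s hs) i = w := by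
  rw [funext_iff]
  refine forall_congr' fun j => ?_
  rw [List.getElem?_eq_getElem (Nat.mod_lt _ hs), Option.some.injEq]
  rfl

theorem mem_linearizedSeqs_iff {s : List Ω} {m : ℕ} :
    s ∈ linearizedSeqs Ω m k ↔ ∀ w : Fin k → Ω, listOccurrences w s = m := Iff.rfl

theorem rotate_eq_map_unroll {s : List Ω} (hs : 0 < s.length) (k : ℕ) :
    s.rotate k = (List.range s.length).map fun i => unroll s hs (i + k) := by
  refine List.ext_getElem (by simp) fun i h _ => ?_
  simp [List.getElem_rotate, unroll]

theorem listOccurrences_eq_card_window [DecidableEq Ω] (w : Fin k → Ω) {s : List Ω}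
    (hs : 0 < s.length) :
    listOccurrences w s
      = ((Finset.range s.length).filter fun i => window k (unroll s hs) i = w).card := by
  classical
  unfold listOccurrences
  congr 1
  ext i
  simp [occursAt_iff_window w hs]

theorem length_of_mem_linearizedSeqs [Fintype Ω] {s : List Ω} {m : ℕ}
    (h : s ∈ linearizedSeqs Ω m k) : s.length = m * Fintype.card Ω ^ k := by
  classical
  rw [mem_linearizedSeqs_iff] at h
  have hsum : ∑ w : Fin k → Ω, listOccurrences w s = s.length := by
    rcases Nat.eq_zero_or_pos s.length with h0 | hs
    · simp [listOccurrences, h0]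
    · conv_rhs => rw [← Finset.card_range s.length,
        Finset.card_eq_sum_card_fiberwise (f := window k (unroll s hs)) (t := Finset.univ)
          (fun _ _ => Finset.mem_univ _)]
      exact Finset.sum_congr rfl fun w _ => listOccurrences_eq_card_window w hs
  rw [← hsum, Finset.sum_congr rfl fun w _ => h w]
  simp [mul_comm]

theorem linearizedSeqs_finite [Fintype Ω] (m k : ℕ) : (linearizedSeqs Ω m k).Finite :=
  (List.finite_length_eq Ω _).subset fun _ hs => length_of_mem_linearizedSeqs hs

theorem linearizedSeqsFrom_finite [Fintype Ω] (y : Fin k → Ω) (m : ℕ) :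
    (linearizedSeqsFrom y m).Finite :=
  (linearizedSeqs_finite m k).subset fun _ hs => hs.1

theorem rotate_mem_eulerianWalks [DecidableEq Ω] {v : Fin k → Ω} {a : Ω} {m : ℕ} (hm : 0 < m)
    {s : List Ω} (hs : s ∈ linearizedSeqsFrom (Fin.snoc v a : Fin (k + 1) → Ω) m) :
    s.rotate k ∈ eulerianWalks shift v a m := by
  obtain ⟨hcount, hocc⟩ := hs
  rw [mem_linearizedSeqs_iff] at hcount
  have hn : 0 < s.length := by
    rw [Nat.pos_iff_ne_zero]
    intro h0
    have := hcount (Fin.snoc v a)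
    simp [listOccurrences, h0] at this
    omega
  rw [occursAt_iff_window _ hn] at hocc
  have hv : window k (unroll s hn) 0 = v := by
    rw [← snoc_window] at hocc
    simpa using congrArg Fin.init hocc
  have ha : unroll s hn k = a := by
    simpa [window] using congrFun hocc (Fin.last k)
  rw [rotate_eq_map_unroll hn]
  refine ⟨?_, ?_, fun u b => ?_⟩
  · conv_lhs => rw [← hv]
    rw [foldl_shift_range, ← hv]
    ext j
    simp [window, unroll]
  · obtain ⟨n, hn'⟩ := Nat.exists_eq_add_of_lt hn
    rw [zero_add] at hn'
    rw [hn', List.range_succ_eq_map]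
    simp [ha]
  · rw [← hv, count_exits_shift_range, ← listOccurrences_eq_card_window]
    exact hcount _

theorem exists_rotate_eq_of_mem_eulerianWalks [DecidableEq Ω] {v : Fin k → Ω} {a : Ω} {m : ℕ}
    {t : List Ω} (ht : t ∈ eulerianWalks shift v a m) :
    ∃ s ∈ linearizedSeqsFrom (Fin.snoc v a : Fin (k + 1) → Ω) m, s.rotate k = t := by
  obtain ⟨hend, hhead, hcount⟩ := ht
  have hn : 0 < t.length := by
    cases t with
    | nil => simp at hhead
    | cons b t => simp
  obtain ⟨n, hnt⟩ : ∃ n, n = t.length := ⟨_, rfl⟩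
  let x : ℕ → Ω := fun i => if h : i < k then v ⟨i, h⟩ else unroll t hn (i - k)
  have hx0 : window k x 0 = v := by
    ext j
    simp [window, x]
  have htx : t = (List.range n).map fun i => x (i + k) := by
    subst hnt
    refine List.ext_getElem (by simp) fun i h _ => ?_
    simp [x, unroll, Nat.mod_eq_of_lt h]
  have hxn : window k x n = v := by
    rw [← foldl_shift_range, ← htx, hx0, hend]
  have hper : ∀ i, x (i + n) = x i := by
    intro i
    by_cases hi : i < k
    · have := congrFun (hxn.trans hx0.symm) ⟨i, hi⟩
      simpa [window, add_comm] using this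
    · have h1 : ¬ i + n < k := by omega
      have h2 : i + n - k = i - k + t.length := by omega
      simp [x, hi, h1, h2, unroll]
  have hmod : ∀ i, x (i % n) = x i := fun i =>
    (show Function.Periodic x n from hper).map_mod_nat i
  let s := (List.range n).map x
  have hsl : s.length = n := by simp [s]
  have hs : 0 < s.length := by omega
  have hux : unroll s hs = x := by
    ext i
    simp only [unroll, s, List.getElem_map, List.getElem_range, List.length_map, List.length_range]
    exact hmod i
  have hrot : s.rotate k = t := by
    rw [rotate_eq_map_unroll hs, hux, hsl, ← htx]
  refine ⟨s, ⟨?_, ?_⟩, hrot⟩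
  · rw [mem_linearizedSeqs_iff]
    intro w
    rw [listOccurrences_eq_card_window w hs, hux, hsl]
    have := hcount (Fin.init w) (w (Fin.last k))
    rw [← hx0, htx, count_exits_shift_range] at this
    simpa using this
  · rw [occursAt_iff_window _ hs, hux, ← snoc_window, hx0]
    congr 1
    obtain ⟨l, hl⟩ := Nat.exists_eq_add_of_lt hn
    rw [zero_add, ← hnt] at hl
    rw [htx, hl, List.range_succ_eq_map] at hhead
    simpa using hhead

theorem ncard_linearizedSeqsFrom_snoc [DecidableEq Ω] (v : Fin k → Ω) (a : Ω) {m : ℕ}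
    (hm : 0 < m) : (linearizedSeqsFrom (Fin.snoc v a : Fin (k + 1) → Ω) m).ncard
      = (eulerianWalks shift v a m).ncard := by
  rw [← Set.ncard_image_of_injective _ (List.rotate_injective k)]
  congr 1
  ext t
  constructor
  · rintro ⟨s, hs, rfl⟩
    exact rotate_mem_eulerianWalks hm hs
  · intro ht
    obtain ⟨s, hs, h⟩ := exists_rotate_eq_of_mem_eulerianWalks ht
    exact ⟨s, hs, h⟩

/-- The number of linearizations that start with `y`, up to a factor that does not depend on the
multiplicity. -/
theorem exists_ncard_linearizedSeqsFrom_mul [Fintype Ω] (hk : 1 ≤ k) (y : Fin k → Ω) :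
    ∃ c : ℕ, 0 < c ∧ ∀ m, 0 < m →
      Fintype.card Ω ^ Fintype.card Ω ^ (k - 1) * (linearizedSeqsFrom y m).ncard
          * m ! ^ (Fintype.card Ω ^ k)
        = c * (m * Fintype.card Ω)! ^ (Fintype.card Ω ^ (k - 1)) := by
  classical
  obtain ⟨k, rfl⟩ := Nat.exists_eq_add_of_le' hk
  obtain ⟨v, a, rfl⟩ : ∃ (v : Fin k → Ω) (a : Ω), y = Fin.snoc v a :=
    ⟨Fin.init y, y (Fin.last k), by simp⟩
  refine ⟨{g : (Fin k → Ω) → Ω | g v = a ∧ LeadsTo shift v g}.ncard, ?_, fun m hm => ?_⟩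
  · rw [Set.ncard_pos (Set.toFinite _)]
    exact exists_leadsTo a fun u => exists_foldl_shift_eq u v
  · have h := ncard_eulerianWalks_mul card_filter_shift_eq v a hm
    rw [Fintype.card_fun, Fintype.card_fin] at h
    rw [Nat.add_sub_cancel, ncard_linearizedSeqsFrom_snoc v a hm, h,
      ← ncard_balancedWords (Ω := Ω) m, mul_pow, ← pow_mul, ← pow_succ']
    ring

theorem linearizedSeqsFrom_nonempty [Fintype Ω] (hk : 1 ≤ k) (y : Fin k → Ω) {m : ℕ}
    (hm : 0 < m) : (linearizedSeqsFrom y m).Nonempty := by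
  obtain ⟨c, hc, h⟩ := exists_ncard_linearizedSeqsFrom_mul hk y
  refine Set.nonempty_of_ncard_ne_zero fun h0 => ?_
  have := h m hm
  rw [h0, mul_zero, zero_mul] at this
  exact (Nat.mul_pos hc (pow_pos (Nat.factorial_pos _) _)).ne this

end Linearizations

section Powers

variable {Ω : Type*} {k : ℕ}

theorem power_succ (t : List Ω) (j : ℕ) : power t (j + 1) = t ++ power t j := by
  simp [power, List.replicate_succ]

theorem length_power (t : List Ω) (j : ℕ) : (power t j).length = j * t.length := by
  simp [power]

theorem append_power_comm (t : List Ω) (j : ℕ) : t ++ power t j = power t j ++ t := by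
  induction j with
  | zero => simp [power]
  | succ j ih => rw [power_succ, List.append_assoc, ← ih]

theorem rotate_power (t : List Ω) (j : ℕ) : (power t j).rotate t.length = power t j := by
  cases j with
  | zero => simp [power]
  | succ j => rw [power_succ, List.rotate_append_length_eq, append_power_comm]

theorem eq_power_of_append_comm {t u : List Ω} {j : ℕ} (h : u ++ t = t ++ u)
    (hl : u.length = j * t.length) : u = power t j := by
  induction j generalizing u with
  | zero => simpa [power] using hl
  | succ j ih =>
    obtain ⟨u', rfl⟩ : t <+: u := by
      refine List.prefix_of_prefix_length_le (List.prefix_append t u)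
        (h ▸ List.prefix_append u t) ?_
      rw [hl, Nat.succ_mul]
      exact Nat.le_add_left _ _
    rw [power_succ, ← ih]
    · simpa using h
    · rw [List.length_append, Nat.succ_mul] at hl
      omega

theorem eq_power_of_rotate_eq {s : List Ω} {j p : ℕ} (hj : 0 < j) (hl : s.length = j * p)
    (h : s.rotate p = s) : s = power (s.take p) j := by
  obtain ⟨j, rfl⟩ := Nat.exists_eq_add_of_le' hj
  have hp : p ≤ s.length := by
    rw [hl, Nat.succ_mul]
    exact Nat.le_add_left _ _
  rw [List.rotate_eq_drop_append_take hp] at h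
  have hd : s.drop p = power (s.take p) j := by
    refine eq_power_of_append_comm (h.trans (List.take_append_drop p s).symm) ?_
    rw [List.length_drop, List.length_take, min_eq_left hp, hl, Nat.succ_mul, Nat.add_sub_cancel]
  rw [power_succ, ← hd, List.take_append_drop]

theorem getElem?_power {t : List Ω} {j i : ℕ} (hi : i < j * t.length) :
    (power t j)[i]? = t[i % t.length]? := by
  induction j generalizing i with
  | zero => simp at hi
  | succ j ih =>
    rw [power_succ]
    rw [Nat.succ_mul] at hi
    by_cases h : i < t.length
    · rw [List.getElem?_append_left h, Nat.mod_eq_of_lt h]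
    · rw [List.getElem?_append_right (by omega), ih (by omega), ← Nat.mod_eq_sub_mod (by omega)]

theorem occursAt_power (w : Fin k → Ω) {t : List Ω} {j : ℕ} (hj : 0 < j) (i : ℕ) :
    OccursAt w (power t j) i ↔ OccursAt w t i := by
  rcases Nat.eq_zero_or_pos t.length with h0 | ht
  · have : t = [] := List.eq_nil_of_length_eq_zero h0
    subst this
    simp [OccursAt, power]
  refine forall_congr' fun l => ?_
  rw [length_power, getElem?_power (Nat.mod_lt _ (Nat.mul_pos hj ht)), Nat.mod_mul_left_mod]

theorem occursAt_add_length (w : Fin k → Ω) (s : List Ω) (i : ℕ) :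
    OccursAt w s (i + s.length) ↔ OccursAt w s i := by
  refine forall_congr' fun l => ?_
  rw [add_right_comm, Nat.add_mod_right]

theorem count_mul_of_periodic (p : ℕ → Prop) [DecidablePred p] {n : ℕ}
    (hp : ∀ i, p (i + n) ↔ p i) (j : ℕ) : Nat.count p (j * n) = j * Nat.count p n := by
  induction j with
  | zero => simp
  | succ j ih =>
    rw [Nat.succ_mul, add_comm, Nat.count_add, Nat.succ_mul, ← ih, add_comm]
    congr 2
    ext i
    rw [add_comm, hp]

theorem listOccurrences_power (w : Fin k → Ω) (t : List Ω) {j : ℕ} (hj : 0 < j) :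
    listOccurrences w (power t j) = j * listOccurrences w t := by
  classical
  unfold listOccurrences
  rw [Finset.filter_congr_decidable, Finset.filter_congr_decidable,
    ← Nat.count_eq_card_filter_range, ← Nat.count_eq_card_filter_range, length_power,
    ← count_mul_of_periodic _ (occursAt_add_length w t)]
  congr 1
  ext i
  exact occursAt_power w hj i

/-- The least positive number of places by which `s` can be rotated without changing. -/
noncomputable def rotationPeriod (s : List Ω) : ℕ :=
  Function.minimalPeriod (fun l : List Ω => l.rotate 1) s

theorem rotate_eq_iterate (s : List Ω) (n : ℕ) :
    (fun l : List Ω => l.rotate 1)^[n] s = s.rotate n := by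
  induction n with
  | zero => simp
  | succ n ih => rw [Function.iterate_succ_apply', ih, List.rotate_rotate]

theorem rotate_eq_self_iff (s : List Ω) (n : ℕ) : s.rotate n = s ↔ rotationPeriod s ∣ n := by
  rw [← rotate_eq_iterate]
  exact Function.isPeriodicPt_iff_minimalPeriod_dvd

theorem rotationPeriod_dvd_length (s : List Ω) : rotationPeriod s ∣ s.length :=
  (rotate_eq_self_iff s _).1 (List.rotate_length s)

theorem rotationPeriod_rotate (s : List Ω) (i : ℕ) :
    rotationPeriod (s.rotate i) = rotationPeriod s := by
  refine Nat.dvd_right_iff_eq.1 fun n => ?_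
  rw [← rotate_eq_self_iff, ← rotate_eq_self_iff, List.rotate_rotate, add_comm,
    ← List.rotate_rotate, List.rotate_eq_rotate]

theorem rotationOrder_eq {s : List Ω} (hs : 0 < s.length) :
    rotationOrder s = s.length / rotationPeriod s := by
  classical
  have hp := Nat.pos_of_dvd_of_pos (rotationPeriod_dvd_length s) hs
  refine le_antisymm (Finset.sup_le fun d hd => ?_) (Finset.le_sup (f := id) ?_)
  · simp only [Finset.mem_filter, Nat.mem_divisors, rotate_eq_self_iff] at hd
    have hle := Nat.le_of_dvd (Nat.div_pos (Nat.le_of_dvd hs hd.1.1)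
      (Nat.pos_of_dvd_of_pos hd.1.1 hs)) hd.2
    rw [id, Nat.le_div_iff_mul_le hp, mul_comm]
    exact (Nat.le_div_iff_mul_le (Nat.pos_of_dvd_of_pos hd.1.1 hs)).1 hle
  · simp only [Finset.mem_filter, Nat.mem_divisors, rotate_eq_self_iff]
    refine ⟨⟨Nat.div_dvd_of_dvd (rotationPeriod_dvd_length s), hs.ne'⟩, ?_⟩
    rw [Nat.div_div_self (rotationPeriod_dvd_length s) hs.ne']

theorem rotationOrder_mul_rotationPeriod {s : List Ω} (hs : 0 < s.length) :
    rotationOrder s * rotationPeriod s = s.length := by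
  rw [rotationOrder_eq hs, Nat.div_mul_cancel (rotationPeriod_dvd_length s)]

theorem dvd_rotationOrder_iff {s : List Ω} (hs : 0 < s.length) {j p : ℕ}
    (h : s.length = j * p) : j ∣ rotationOrder s ↔ s.rotate p = s := by
  rw [rotate_eq_self_iff]
  have h' := rotationOrder_mul_rotationPeriod hs
  have hp := Nat.pos_of_dvd_of_pos (rotationPeriod_dvd_length s) hs
  have hj : 0 < j := Nat.pos_of_ne_zero fun h0 => by
    rw [h0, zero_mul] at h
    omega
  constructor
  · rintro ⟨c, hc⟩
    refine ⟨c, Nat.eq_of_mul_eq_mul_left hj ?_⟩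
    rw [← h, ← h', hc]
    ring
  · rintro ⟨c, hc⟩
    refine ⟨c, Nat.eq_of_mul_eq_mul_right hp ?_⟩
    rw [h', h, hc]
    ring

theorem eq_power_rotationOrder {s : List Ω} (hs : 0 < s.length) :
    s = power (s.take (rotationPeriod s)) (rotationOrder s) :=
  eq_power_of_rotate_eq
    (Nat.pos_of_ne_zero fun h0 => by
      have := rotationOrder_mul_rotationPeriod hs
      rw [h0, zero_mul] at this
      omega)
    (rotationOrder_mul_rotationPeriod hs).symm ((rotate_eq_self_iff s _).2 dvd_rfl)

end Powers

section Orders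

variable {Ω : Type*} [Fintype Ω] [Nonempty Ω] {k : ℕ}

theorem length_pos_of_mem_linearizedSeqs {s : List Ω} {m : ℕ} (hm : 0 < m)
    (h : s ∈ linearizedSeqs Ω m k) : 0 < s.length := by
  rw [length_of_mem_linearizedSeqs h]
  exact Nat.mul_pos hm (pow_pos Fintype.card_pos _)

theorem rotationOrder_dvd {s : List Ω} {m : ℕ} (hm : 0 < m) (h : s ∈ linearizedSeqs Ω m k) :
    rotationOrder s ∣ m := by
  have hs := length_pos_of_mem_linearizedSeqs hm h
  have hd : 0 < rotationOrder s := Nat.pos_of_dvd_of_pos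
    (Dvd.intro _ (rotationOrder_mul_rotationPeriod hs)) hs
  let w : Fin k → Ω := fun _ => Classical.arbitrary Ω
  have hw := mem_linearizedSeqs_iff.1 h w
  rw [eq_power_rotationOrder hs, listOccurrences_power w _ hd] at hw
  exact Dvd.intro _ hw

theorem image_power_linearizedSeqsFrom (y : Fin k → Ω) {r j : ℕ} (hr : 0 < r) (hj : 0 < j) :
    (fun t => power t j) '' linearizedSeqsFrom y r
      = {s ∈ linearizedSeqsFrom y (r * j) | j ∣ rotationOrder s} := by
  ext s
  constructor
  · rintro ⟨t, ⟨ht, hy⟩, rfl⟩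
    have hmem : power t j ∈ linearizedSeqs Ω (r * j) k := by
      rw [mem_linearizedSeqs_iff] at ht ⊢
      intro w
      rw [listOccurrences_power w t hj, ht w, mul_comm]
    refine ⟨⟨hmem, (occursAt_power y hj 0).2 hy⟩, ?_⟩
    exact (dvd_rotationOrder_iff (length_pos_of_mem_linearizedSeqs (Nat.mul_pos hr hj) hmem)
      (length_power t j)).2 (rotate_power t j)
  · rintro ⟨⟨hs, hy⟩, hdvd⟩
    have hpos := length_pos_of_mem_linearizedSeqs (Nat.mul_pos hr hj) hs
    have hl : s.length = j * (r * Fintype.card Ω ^ k) := by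
      rw [length_of_mem_linearizedSeqs hs]
      ring
    have heq := eq_power_of_rotate_eq hj hl ((dvd_rotationOrder_iff hpos hl).1 hdvd)
    refine ⟨s.take (r * Fintype.card Ω ^ k), ⟨?_, ?_⟩, heq.symm⟩
    · rw [mem_linearizedSeqs_iff] at hs ⊢
      intro w
      have := hs w
      rw [heq, listOccurrences_power w _ hj, mul_comm r j] at this
      exact Nat.eq_of_mul_eq_mul_left hj this
    · rw [heq] at hy
      exact (occursAt_power y hj 0).1 hy

omit [Nonempty Ω] in
theorem power_injOn_linearizedSeqsFrom (y : Fin k → Ω) (r : ℕ) {j : ℕ} (hj : 0 < j) :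
    Set.InjOn (fun t => power t j) (linearizedSeqsFrom y r) := by
  intro t ht t' ht' h
  obtain ⟨j, rfl⟩ := Nat.exists_eq_add_of_le' hj
  simp only [power_succ] at h
  exact List.append_inj_left h
    ((length_of_mem_linearizedSeqs ht.1).trans (length_of_mem_linearizedSeqs ht'.1).symm)

omit [Fintype Ω] [Nonempty Ω] in
theorem rotationOrder_eq_of_coe_eq {s s' : List Ω} (hs : 0 < s.length)
    (h : (s' : Cycle Ω) = (s : Cycle Ω)) : rotationOrder s' = rotationOrder s := by
  obtain ⟨i, rfl⟩ := Cycle.coe_eq_coe.1 h.symm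
  rw [rotationOrder_eq hs, rotationOrder_eq (by rwa [List.length_rotate]), List.length_rotate,
    rotationPeriod_rotate]

omit [Fintype Ω] [Nonempty Ω] in
theorem rotate_mod_rotationPeriod (s : List Ω) (i : ℕ) :
    s.rotate (i % rotationPeriod s) = s.rotate i := by
  conv_rhs => rw [← Nat.div_add_mod i (rotationPeriod s), ← List.rotate_rotate,
    (rotate_eq_self_iff s _).2 (dvd_mul_right _ _)]

omit [Fintype Ω] [Nonempty Ω] in
theorem occursAt_rotate_zero (w : Fin k → Ω) {s : List Ω} (hs : 0 < s.length) (i : ℕ) :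
    OccursAt w (s.rotate i) 0 ↔ OccursAt w s i := by
  rw [occursAt_rotate w s i 0 hs, zero_add, occursAt_iff_window w hs, occursAt_iff_window w hs]
  have : window k (unroll s hs) (i % s.length) = window k (unroll s hs) i := by
    ext j
    simp [window, unroll]
  rw [this]

theorem ncard_linearizations_mul_rotationOrder (y : Fin k → Ω) {m : ℕ} (hm : 0 < m) {s : List Ω}
    (h : s ∈ linearizedSeqs Ω m k) :
    {s' ∈ linearizedSeqsFrom y m | (s' : Cycle Ω) = s}.ncard * rotationOrder s = m := by
  classical
  have hs := length_pos_of_mem_linearizedSeqs hm h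
  have hp : 0 < rotationPeriod s := Nat.pos_of_dvd_of_pos (rotationPeriod_dvd_length s) hs
  have hd : 0 < rotationOrder s := Nat.pos_of_dvd_of_pos
    (Dvd.intro _ (rotationOrder_mul_rotationPeriod hs)) hs
  have himage : {s' ∈ linearizedSeqsFrom y m | (s' : Cycle Ω) = s}
      = (fun i => s.rotate i) ''
        ((Finset.range (rotationPeriod s)).filter fun i => OccursAt y s i : Set ℕ) := by
    ext s'
    simp only [Finset.coe_filter, Finset.mem_range, Set.mem_image, Set.mem_ofPred_eq]
    constructor
    · rintro ⟨⟨_, hy⟩, hc⟩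
      obtain ⟨i, rfl⟩ := Cycle.coe_eq_coe.1 hc.symm
      refine ⟨i % rotationPeriod s, ⟨Nat.mod_lt _ hp, ?_⟩, rotate_mod_rotationPeriod s i⟩
      rwa [← occursAt_rotate_zero y hs, rotate_mod_rotationPeriod]
    · rintro ⟨i, ⟨_, hy⟩, rfl⟩
      have hc : (s.rotate i : Cycle Ω) = s := Cycle.coe_eq_coe.2 (List.IsRotated.forall s i)
      refine ⟨⟨?_, (occursAt_rotate_zero y hs i).2 hy⟩, hc⟩
      change (s.rotate i : Cycle Ω) ∈ cyclicSeqs Ω m k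
      rw [hc]
      exact h
  have hinj : Set.InjOn (fun i => s.rotate i)
      ((Finset.range (rotationPeriod s)).filter fun i => OccursAt y s i : Set ℕ) := by
    intro i hi i' hi' hii'
    simp only [Finset.coe_filter, Finset.mem_range, Set.mem_ofPred_eq] at hi hi'
    refine Function.iterate_injOn_Iio_minimalPeriod (f := fun l : List Ω => l.rotate 1) (x := s)
      hi.1 hi'.1 ?_
    simpa only [rotate_eq_iterate] using hii'
  have hocc := mem_linearizedSeqs_iff.1 h y
  rw [eq_power_rotationOrder hs, listOccurrences_power y _ hd] at hocc
  rw [himage, hinj.ncard_image, Set.ncard_coe_finset, mul_comm]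
  refine Eq.trans ?_ hocc
  congr 1
  unfold listOccurrences
  rw [List.length_take, min_eq_left (Nat.le_of_dvd hs (rotationPeriod_dvd_length s))]
  congr 1
  ext i
  simp only [Finset.mem_filter]
  rw [← occursAt_power y (t := s.take _) hd, ← eq_power_rotationOrder hs]

theorem coe_power_mem_cyclicSeqs {y : Fin k → Ω} {m r : ℕ} (hm : 0 < m) (hr : r ∣ m)
    {t : List Ω} (ht : t ∈ linearizedSeqsFrom y r) :
    (power t (m / r) : Cycle Ω) ∈ cyclicSeqs Ω m k := by
  have h := (image_power_linearizedSeqsFrom y (Nat.pos_of_dvd_of_pos hr hm)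
    (Nat.div_pos (Nat.le_of_dvd hm hr) (Nat.pos_of_dvd_of_pos hr hm))).subset
    (Set.mem_image_of_mem _ ht)
  rw [Nat.mul_div_cancel' hr] at h
  exact h.1.1

theorem sum_totient_mul_ncard_powers (y : Fin k → Ω) {m : ℕ} (hm : 0 < m) {σ : Cycle Ω}
    (hσ : σ ∈ cyclicSeqs Ω m k) :
    ∑ r ∈ m.divisors, φ (m / r) *
      {t ∈ linearizedSeqsFrom y r | (power t (m / r) : Cycle Ω) = σ}.ncard = m := by
  induction σ using Quotient.inductionOn with
  | h s =>
  change s ∈ linearizedSeqs Ω m k at hσ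
  have hs := length_pos_of_mem_linearizedSeqs hm hσ
  have hterm : ∀ r ∈ m.divisors,
      {t ∈ linearizedSeqsFrom y r | (power t (m / r) : Cycle Ω) = s}.ncard
        = if m / r ∣ rotationOrder s then
            {s' ∈ linearizedSeqsFrom y m | (s' : Cycle Ω) = s}.ncard else 0 := by
    intro r hr
    have hr := Nat.dvd_of_mem_divisors hr
    have hr0 := Nat.pos_of_dvd_of_pos hr hm
    have hj : 0 < m / r := Nat.div_pos (Nat.le_of_dvd hm hr) hr0
    have himage := image_power_linearizedSeqsFrom y hr0 hj
    rw [Nat.mul_div_cancel' hr] at himage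
    rw [← ((power_injOn_linearizedSeqsFrom y r hj).mono (Set.sep_subset _ _)).ncard_image]
    have : (fun t => power t (m / r)) ''
        {t ∈ linearizedSeqsFrom y r | (power t (m / r) : Cycle Ω) = s}
        = {s' ∈ linearizedSeqsFrom y m | (s' : Cycle Ω) = s ∧ m / r ∣ rotationOrder s} := by
      ext s'
      constructor
      · rintro ⟨t, ⟨ht, htc⟩, rfl⟩
        have h := himage.subset (Set.mem_image_of_mem _ ht)
        exact ⟨h.1, htc, rotationOrder_eq_of_coe_eq hs htc ▸ h.2⟩
      · rintro ⟨hs', hc, hdvd⟩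
        rw [← rotationOrder_eq_of_coe_eq hs hc] at hdvd
        obtain ⟨t, ht, rfl⟩ := himage.superset ⟨hs', hdvd⟩
        exact ⟨t, ⟨ht, hc⟩, rfl⟩
    rw [this]
    split_ifs with hdvd
    · simp [hdvd]
    · simp [hdvd]
  have hD := rotationOrder_dvd hm hσ
  calc _ = ∑ r ∈ m.divisors, φ (m / r) * (if m / r ∣ rotationOrder s then
            {s' ∈ linearizedSeqsFrom y m | (s' : Cycle Ω) = s}.ncard else 0) :=
        Finset.sum_congr rfl fun r hr => congrArg _ (hterm r hr)
    _ = ∑ e ∈ m.divisors, φ e * (if e ∣ rotationOrder s then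
            {s' ∈ linearizedSeqsFrom y m | (s' : Cycle Ω) = s}.ncard else 0) :=
        Nat.sum_div_divisors m fun e => φ e * (if e ∣ rotationOrder s then
            {s' ∈ linearizedSeqsFrom y m | (s' : Cycle Ω) = s}.ncard else 0)
    _ = ∑ e ∈ (rotationOrder s).divisors, φ e *
            {s' ∈ linearizedSeqsFrom y m | (s' : Cycle Ω) = s}.ncard := by
        rw [← Nat.divisors_filter_dvd_of_dvd hm.ne' hD, Finset.sum_filter]
        exact Finset.sum_congr rfl fun e _ => by split_ifs <;> simp
    _ = m := by
        rw [← Finset.sum_mul, Nat.sum_totient, mul_comm]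
        exact ncard_linearizations_mul_rotationOrder y hm hσ

omit [Nonempty Ω] in
theorem cyclicSeqs_finite (m k : ℕ) : (cyclicSeqs Ω m k).Finite := by
  refine ((linearizedSeqs_finite (Ω := Ω) m k).image fun s : List Ω => (s : Cycle Ω)).subset
    fun σ hσ => ?_
  induction σ using Quotient.inductionOn with
  | h s => exact ⟨s, hσ, rfl⟩

omit [Nonempty Ω] in
theorem cyclicSeqs_nonempty (hk : 1 ≤ k) (y : Fin k → Ω) {m : ℕ} (hm : 0 < m) :
    (cyclicSeqs Ω m k).Nonempty :=
  (linearizedSeqsFrom_nonempty hk y hm).elim fun s hs => ⟨(s : Cycle Ω), hs.1⟩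

theorem sum_totient_mul_ncard_linearizedSeqsFrom (y : Fin k → Ω) {m : ℕ} (hm : 0 < m) :
    ∑ r ∈ m.divisors, φ (m / r) * (linearizedSeqsFrom y r).ncard
      = m * (cyclicSeqs Ω m k).ncard := by
  have hC := cyclicSeqs_finite (Ω := Ω) m k
  have hfib : ∀ r ∈ m.divisors, φ (m / r) * (linearizedSeqsFrom y r).ncard
      = ∑ σ ∈ hC.toFinset, φ (m / r) *
        {t ∈ linearizedSeqsFrom y r | (power t (m / r) : Cycle Ω) = σ}.ncard := by
    intro r hr
    rw [← Finset.mul_sum, ncard_eq_sum_ncard_fiber (linearizedSeqsFrom_finite y r)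
      (fun t => (power t (m / r) : Cycle Ω)) hC.toFinset]
    intro t ht
    rw [Set.Finite.mem_toFinset]
    exact coe_power_mem_cyclicSeqs hm (Nat.dvd_of_mem_divisors hr) ht
  rw [Finset.sum_congr rfl hfib, Finset.sum_comm,
    Finset.sum_congr rfl fun σ hσ => sum_totient_mul_ncard_powers y hm (hC.mem_toFinset.1 hσ),
    Finset.sum_const, smul_eq_mul, Set.ncard_eq_toFinset_card _ hC, mul_comm]

end Orders

section Sampling

theorem map_uniformOn_apply {α β : Type*} {S : Set α} (hf : S.Finite) (hn : S.Nonempty)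
    (f : α → β) (b : β) :
    (uniformOn S hf hn).map f b
      = ENNReal.ofReal (({a ∈ S | f a = b}.ncard : ℝ) / (S.ncard : ℝ)) := by
  classical
  rw [← PMF.toOuterMeasure_apply_singleton, PMF.toOuterMeasure_map_apply, uniformOn,
    PMF.toOuterMeasure_uniformOfFinset_apply,
    ENNReal.ofReal_div_of_pos (by exact_mod_cast (Set.ncard_pos hf).2 hn),
    ENNReal.ofReal_natCast, ENNReal.ofReal_natCast, Set.ncard_eq_toFinset_card S hf,
    ← Set.ncard_coe_finset]
  congr 3
  ext a
  simp

variable {Ω : Type*} [Fintype Ω] [Nonempty Ω] {k : ℕ}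

omit [Fintype Ω] [Nonempty Ω] in
theorem weight_nonneg (y : Fin k → Ω) (m r : ℕ) : 0 ≤ weight y m r := by
  unfold weight
  positivity

theorem sum_weight (hk : 1 ≤ k) (y : Fin k → Ω) {m : ℕ} (hm : 0 < m) :
    ∑ r ∈ m.divisors, weight y m r = 1 := by
  have hC : (0 : ℝ) < (cyclicSeqs Ω m k).ncard := by
    exact_mod_cast (Set.ncard_pos (cyclicSeqs_finite m k)).2 (cyclicSeqs_nonempty hk y hm)
  have hm' : (0 : ℝ) < m := by exact_mod_cast hm
  have h : ∑ r ∈ m.divisors, (φ (m / r) : ℝ) * ((linearizedSeqsFrom y r).ncard : ℝ)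
      = m * (cyclicSeqs Ω m k).ncard := by
    exact_mod_cast sum_totient_mul_ncard_linearizedSeqsFrom y hm
  simp only [weight, div_mul_div_comm]
  rw [← Finset.sum_div, h, div_self (mul_pos hm' hC).ne']

theorem weight_eq (hk : 1 ≤ k) (y : Fin k → Ω) {m r : ℕ} (hm : 0 < m) (hr : r ∣ m) :
    weight y m r =
      ((φ (m / r) : ℝ) * ((r * Fintype.card Ω)! : ℝ) ^ (Fintype.card Ω ^ (k - 1)) /
          (r ! : ℝ) ^ (Fintype.card Ω ^ k)) /
        ∑ d ∈ m.divisors,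
          (φ (m / d) : ℝ) * ((d * Fintype.card Ω)! : ℝ) ^ (Fintype.card Ω ^ (k - 1)) /
            (d ! : ℝ) ^ (Fintype.card Ω ^ k) := by
  obtain ⟨c, hc, h⟩ := exists_ncard_linearizedSeqsFrom_mul hk y
  have hc' : (0 : ℝ) < c := by exact_mod_cast hc
  have hq : (0 : ℝ) < (Fintype.card Ω : ℝ) ^ Fintype.card Ω ^ (k - 1) :=
    pow_pos (by exact_mod_cast Fintype.card_pos) _
  set κ : ℝ := c / (Fintype.card Ω : ℝ) ^ Fintype.card Ω ^ (k - 1) with hκ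
  have hκ0 : κ ≠ 0 := (div_pos hc' hq).ne'
  have hterm : ∀ d ∈ m.divisors, (φ (m / d) : ℝ) * ((linearizedSeqsFrom y d).ncard : ℝ)
      = κ * ((φ (m / d) : ℝ) * ((d * Fintype.card Ω)! : ℝ) ^ (Fintype.card Ω ^ (k - 1)) /
            (d ! : ℝ) ^ (Fintype.card Ω ^ k)) := by
    intro d hd
    have hd : (_ : ℝ) = _ := congrArg Nat.cast
      (h d (Nat.pos_of_dvd_of_pos (Nat.dvd_of_mem_divisors hd) hm))
    push_cast at hd
    have hf : (0 : ℝ) < (d ! : ℝ) ^ (Fintype.card Ω ^ k) :=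
      pow_pos (by exact_mod_cast Nat.factorial_pos d) _
    rw [hκ]
    field_simp
    linear_combination (φ (m / d) : ℝ) * hd
  have hsum : (m : ℝ) * ((cyclicSeqs Ω m k).ncard : ℝ)
      = κ * ∑ d ∈ m.divisors,
          (φ (m / d) : ℝ) * ((d * Fintype.card Ω)! : ℝ) ^ (Fintype.card Ω ^ (k - 1)) /
            (d ! : ℝ) ^ (Fintype.card Ω ^ k) := by
    rw [Finset.mul_sum, ← Finset.sum_congr rfl hterm]
    exact_mod_cast (sum_totient_mul_ncard_linearizedSeqsFrom y hm).symm
  rw [weight, div_mul_div_comm, hsum, hterm r (Nat.mem_divisors.2 ⟨hr, hm.ne'⟩),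
    mul_div_mul_left _ _ hκ0]

/-- The weights as a probability distribution. -/
noncomputable def weightPMF (hk : 1 ≤ k) (y : Fin k → Ω) {m : ℕ} (hm : 0 < m) :
    PMF m.divisors :=
  PMF.ofFintype (fun r => ENNReal.ofReal (weight y m r)) (by
    rw [← ENNReal.ofReal_sum_of_nonneg fun (r : m.divisors) _ => weight_nonneg y m (r : ℕ),
      Finset.sum_coe_sort m.divisors (weight y m), sum_weight hk y hm, ENNReal.ofReal_one])

theorem outputLaw_weightPMF_apply (hk : 1 ≤ k) (y : Fin k → Ω) {m : ℕ} (hm : 0 < m)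
    (hf : ∀ r : m.divisors, (linearizedSeqsFrom y (r : ℕ)).Finite)
    (hn : ∀ r : m.divisors, (linearizedSeqsFrom y (r : ℕ)).Nonempty) (σ : Cycle Ω) :
    outputLaw y m (weightPMF hk y hm) hf hn σ
      = ENNReal.ofReal ((∑ r ∈ m.divisors, (φ (m / r) : ℝ) *
          ({t ∈ linearizedSeqsFrom y r | (power t (m / r) : Cycle Ω) = σ}.ncard : ℝ))
            / (m * (cyclicSeqs Ω m k).ncard)) := by
  rw [outputLaw, PMF.bind_apply, tsum_fintype, Finset.sum_div, ← Finset.sum_coe_sort m.divisors,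
    ENNReal.ofReal_sum_of_nonneg fun r _ => by positivity]
  refine Finset.sum_congr rfl fun r _ => ?_
  rw [map_uniformOn_apply, weightPMF, PMF.ofFintype_apply,
    ← ENNReal.ofReal_mul (weight_nonneg y m r)]
  congr 1
  have hL : ((linearizedSeqsFrom y (r : ℕ)).ncard : ℝ) ≠ 0 := by
    exact_mod_cast ((Set.ncard_pos (hf r)).2 (hn r)).ne'
  rw [weight, div_mul_div_comm, div_mul_div_comm, mul_right_comm, mul_div_mul_right _ _ hL]

end Sampling

end MultiDeBruijn

theorem mainTheorem11 {Ω : Type*} [Fintype Ω] [Nonempty Ω] (m k : ℕ) (hm : 1 ≤ m) (hk : 1 ≤ k)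
    (y : Fin k → Ω) :
    -- powers of linearizations, decomposed by order
    (∀ r : ℕ, r ∣ m →
      {s : List Ω | ∃ t ∈ MultiDeBruijn.linearizedSeqsFrom y r,
          s = MultiDeBruijn.power t (m / r)} =
        ⋃ d ∈ {d : ℕ | d ∣ m ∧ m / r ∣ d}, MultiDeBruijn.linearizedSeqsFromOfOrder y d m) ∧
    -- the closed form of the weights
    (∀ r : ℕ, r ∣ m →
      MultiDeBruijn.weight y m r =
        ((φ (m / r) : ℝ) * ((r * Fintype.card Ω)! : ℝ) ^ (Fintype.card Ω ^ (k - 1)) /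
            (r ! : ℝ) ^ (Fintype.card Ω ^ k)) /
          ∑ d ∈ m.divisors,
            (φ (m / d) : ℝ) * ((d * Fintype.card Ω)! : ℝ) ^ (Fintype.card Ω ^ (k - 1)) /
              (d ! : ℝ) ^ (Fintype.card Ω ^ k)) ∧
    -- the process is well defined, and its output is uniform
    (MultiDeBruijn.cyclicSeqs Ω m k).Finite ∧
    (MultiDeBruijn.cyclicSeqs Ω m k).Nonempty ∧
    ∃ (hf : ∀ r : m.divisors, (MultiDeBruijn.linearizedSeqsFrom y (r : ℕ)).Finite)
      (hn : ∀ r : m.divisors, (MultiDeBruijn.linearizedSeqsFrom y (r : ℕ)).Nonempty)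
      (P : PMF m.divisors),
      (∀ r : m.divisors, P r = ENNReal.ofReal (MultiDeBruijn.weight y m (r : ℕ))) ∧
      (∀ σ ∈ MultiDeBruijn.cyclicSeqs Ω m k,
        MultiDeBruijn.outputLaw y m P hf hn σ =
          1 / ((MultiDeBruijn.cyclicSeqs Ω m k).ncard : ℝ≥0∞)) ∧
      (∀ σ ∉ MultiDeBruijn.cyclicSeqs Ω m k, MultiDeBruijn.outputLaw y m P hf hn σ = 0) := by
  have hC := MultiDeBruijn.cyclicSeqs_finite (Ω := Ω) m k
  have hC' := MultiDeBruijn.cyclicSeqs_nonempty hk y hm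
  refine ⟨fun r hr => ?_, fun r hr => MultiDeBruijn.weight_eq hk y hm hr, hC, hC',
    fun r => MultiDeBruijn.linearizedSeqsFrom_finite y r,
    fun r => MultiDeBruijn.linearizedSeqsFrom_nonempty hk y (Nat.pos_of_mem_divisors r.2),
    MultiDeBruijn.weightPMF hk y hm, fun r => rfl, fun σ hσ => ?_, fun σ hσ => ?_⟩
  · have hr0 := Nat.pos_of_dvd_of_pos hr hm
    have h := MultiDeBruijn.image_power_linearizedSeqsFrom y hr0
      (Nat.div_pos (Nat.le_of_dvd hm hr) hr0)
    rw [Nat.mul_div_cancel' hr] at h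
    ext s
    simp only [Set.mem_iUnion, exists_prop]
    constructor
    · rintro ⟨t, ht, rfl⟩
      have hs := h.subset (Set.mem_image_of_mem _ ht)
      exact ⟨_, ⟨MultiDeBruijn.rotationOrder_dvd hm hs.1.1, hs.2⟩, hs.1, rfl⟩
    · rintro ⟨_, ⟨_, hd⟩, hs, rfl⟩
      obtain ⟨t, ht, hts⟩ := h.superset ⟨hs, hd⟩
      exact ⟨t, ht, hts.symm⟩
  · have hm' : (m : ℝ) ≠ 0 := by exact_mod_cast (Nat.pos_iff_ne_zero.1 hm)
    have hsum : (_ : ℝ) = _ :=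
      congrArg Nat.cast (MultiDeBruijn.sum_totient_mul_ncard_powers y hm hσ)
    push_cast at hsum
    rw [MultiDeBruijn.outputLaw_weightPMF_apply, hsum, div_mul_cancel_left₀ hm', one_div,
      ENNReal.ofReal_inv_of_pos (by exact_mod_cast (Set.ncard_pos hC).2 hC'),
      ENNReal.ofReal_natCast]
  · rw [MultiDeBruijn.outputLaw_weightPMF_apply, Finset.sum_eq_zero, zero_div,
      ENNReal.ofReal_zero]
    intro r hr
    have : {t ∈ MultiDeBruijn.linearizedSeqsFrom y r |
        (MultiDeBruijn.power t (m / r) : Cycle Ω) = σ} = ∅ := by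
      refine Set.eq_empty_of_forall_notMem fun t ht => hσ ?_
      rw [← ht.2]
      exact MultiDeBruijn.coe_power_mem_cyclicSeqs hm (Nat.dvd_of_mem_divisors hr) ht.1
    rw [this, Set.ncard_empty, Nat.cast_zero, mul_zero]
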